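/- Let $F$ be a finite field with $|F|=q$, let $\lambda\in F^\times$ have multiplicative order $t$, and let $\alpha,\alpha'>0$ be integers with $\alpha'\equiv\alpha\pmod t$ and $\gcd(\alpha,t)=1$; put $\alpha''=\min\{\alpha',\alpha\}$. For an integer $k$ coprime to $t$ write $\lambda^{1/k}:=\lambda^{j}$, where $jk\equiv1\pmod t$. For an integer $n\ge2$ coprime to $qt$ and for $\beta\in\{\alpha',\alpha\}$ set $\mathcal R_{\lambda,\beta}=F[X]/\langle X^{\beta n}-\lambda\rangle$ and let $\mathcal I_{\lambda,\beta}$ be the ideal of $\mathcal R_{\lambda,\beta}$ generated by $$\psi^+_{\lambda,\beta}(X)=\Big(\frac{X}{\lambda^{1/(\beta n)}}-1\Big)\sum_{j=0}^{\beta-1}(X^n)^{\beta-1-j}\big(\lambda^{1/\beta}\big)^{j}.$$ For $(a',a)\in\mathcal I_{\lambda,\alpha'}\times\mathcal I_{\lambda,\alpha}$ let $C_{a',a}=F[X](a',a)$ be the $F[X]$-submodule of $\mathcal R_{\lambda,\alpha'}\times\mathcal R_{\lambda,\alpha}$ generated by $(a',a)$. Identify an element of $\mathcal R_{\lambda,\alpha'}\times\mathcal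 R_{\lambda,\alpha}$ with the word in $F^{\alpha'n+\alpha n}$ formed by the coefficients of the reduced representatives of its two components (of degrees less than $\alpha'n$ and $\alpha n$), and let the relative minimum distance $\Delta(C)$ of a submodule $C\ne0$ be the least Hamming weight of a nonzero element of $C$ divided by $\alpha'n+\alpha n$; set $\Delta(0)=0$. Let $\mu(n)$ be the least degree of an irreducible factor of $1+X+\cdots+X^{n-1}$ in $F[X]$. Let $n_1,n_2,\dots\ge2$ be integers with $\gcd(n_i,qt)=1$ for all $i$ and $\lim_{i\to\infty}\frac{\log_q n_i}{\mu(n_i)}=0$. Let $C^{(i)}_{a',a}$ be the random code $C_{a',a}$ for $n=n_i$, where $(a',a)$ is chosen uniformly at random from $\mathcal I_{\lambda,\alpha'}\times\mathcal I_{\lambda,\alpha}$. Let $h_q(x)=x\log_q(q-1)-x\log_q x-(1-x)\log_q(1-x)$ for $x\in[0,1-q^{-1}]$ (with $0\log_q0=0$), and let $\delta\in(0,1-q^{-1})$ be such that $\frac{\alpha'+\alpha}{2\alpha''}\delta\le1-q^{-1}$ and $h_q\big(\frac{\alpha'+\alpha}{2\alpha''}\delta\big)<\frac12$. Then (1) $\lim_{i\to\infty}\Pr\big(\Delta(C^{(i)}_{a',a})>\delta\big)=1$;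 (2) $\lim_{i\to\infty}\Pr\big(\dim_F C^{(i)}_{a',a}=n_i-1\big)=1$. -/

import Mathlib

open Polynomial Filter Topology

/-- The `q`-ary entropy (logarithms to base `q`), from Mathlib's `Real.qaryEntropy`, which uses
natural logarithms. Only its values on `[0, 1 - 1/q]` are used. -/
noncomputable def entropyBase (q : ℕ) (x : ℝ) : ℝ :=
  Real.qaryEntropy q x / Real.log q

theorem entropyBase_eq (q : ℕ) (x : ℝ) :
    entropyBase q x = x * Real.logb q ((q : ℝ) - 1) - x * Real.logb q x
      - (1 - x) * Real.logb q (1 - x) := by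
  simp only [entropyBase, Real.qaryEntropy, Real.binEntropy, Real.logb, Real.log_inv]
  push_cast
  ring

namespace TwistedCode

variable {F : Type*} [Field F]

/-- The ring `F[X] / ⟨X ^ N - lam⟩`; it is an algebra over `F` and over `F[X]`. -/
abbrev Ambient (lam : Fˣ) (N : ℕ) : Type _ :=
  F[X] ⧸ Ideal.span {(X ^ N - C (lam : F) : F[X])}

/-- The word `(c_0, …, c_{N-1})` of an element `a = c_0 + c_1 X + ⋯ + c_{N-1} X ^ (N-1)` of
`F[X] / ⟨X ^ N - lam⟩`: the coefficients of the remainder of any representative of `a` modulo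
`X ^ N - lam` (see `word_mk` for the independence of the representative). -/
noncomputable def word {lam : Fˣ} {N : ℕ} (a : Ambient lam N) : Fin N → F :=
  fun j => ((Quotient.out a : F[X]) %ₘ (X ^ N - C (lam : F))).coeff j

theorem word_mk {lam : Fˣ} {N : ℕ} (hN : N ≠ 0) (f : F[X]) (j : Fin N) :
    word (Ideal.Quotient.mk (Ideal.span {(X ^ N - C (lam : F) : F[X])}) f : Ambient lam N) j
      = (f %ₘ (X ^ N - C (lam : F))).coeff j := by
  have hm : (X ^ N - C (lam : F) : F[X]).Monic := monic_X_pow_sub_C _ hN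
  unfold word
  congr 1
  rw [modByMonic_eq_of_dvd_sub hm]
  rw [← Ideal.mem_span_singleton, ← Ideal.Quotient.eq]
  exact Quotient.out_eq _

/-- The root `lam ^ (1 / k)` inside the cyclic group generated by `lam`, where `1 / k` is the
inverse of `k` modulo the order of `lam` (used for `k` coprime to that order). -/
noncomputable def unitRoot (lam : Fˣ) (k : ℕ) : Fˣ :=
  lam ^ ((k : ZMod (orderOf lam))⁻¹).val

theorem unitRoot_pow [Finite F] (lam : Fˣ) (k : ℕ) (hk : k.Coprime (orderOf lam)) :
    unitRoot lam k ^ k = lam := by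
  have : NeZero (orderOf lam) := ⟨(orderOf_pos lam).ne'⟩
  have h := ZMod.coe_mul_inv_eq_one k hk
  rw [unitRoot, ← pow_mul]
  conv_rhs => rw [← pow_one lam]
  rw [pow_eq_pow_iff_modEq, ← ZMod.natCast_eq_natCast_iff]
  push_cast
  rw [ZMod.natCast_zmod_val, mul_comm, h]

/-- `ψ(X) = (X^n)^(k-1) + (X^n)^(k-2) r + ⋯ + r^(k-1)` with `r = lam ^ (1/k)`. -/
noncomputable def psi (lam : Fˣ) (k n : ℕ) : F[X] :=
  ∑ j ∈ Finset.range k, (X ^ n) ^ (k - 1 - j) * C (unitRoot lam k : F) ^ j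

/-- `ψ⁺(X) = (X / s - 1) ψ(X)` with `s = lam ^ (1/(k n))`. -/
noncomputable def psiPlus (lam : Fˣ) (k n : ℕ) : F[X] :=
  (C ((unitRoot lam (k * n))⁻¹ : Fˣ).val * X - 1) * psi lam k n

/-- The ideal generated by `ψ⁺` in `F[X] / ⟨X ^ (k n) - lam⟩`. -/
noncomputable def genIdeal (lam : Fˣ) (k n : ℕ) : Ideal (Ambient lam (k * n)) :=
  Ideal.span {Ideal.Quotient.mk _ (psiPlus lam k n)}

variable (F) in
/-- The least degree of an irreducible factor of `(X ^ n - 1) / (X - 1) = 1 + X + ⋯ + X ^ (n-1)`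
over `F` (meant for `n ≥ 2`; for `n = 1` there is no such factor). -/
noncomputable def minFactorDegree (n : ℕ) : ℕ :=
  sInf {d | ∃ φ : F[X], Irreducible φ ∧ φ ∣ ∑ j ∈ Finset.range n, X ^ j ∧ φ.natDegree = d}

/-- A double `lam`-twisted code of cycle length `(N', N)`: an `F[X]`-submodule of
`F[X] / ⟨X ^ N' - lam⟩ × F[X] / ⟨X ^ N - lam⟩`. -/
abbrev DoubleCode (lam : Fˣ) (N' N : ℕ) : Type _ :=
  Submodule F[X] (Ambient lam N' × Ambient lam N)

/-- The code generated over `F[X]` by the single element `(a', a)`. -/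
noncomputable def oneGenCode {lam : Fˣ} {N' N : ℕ} (a' : Ambient lam N') (a : Ambient lam N) :
    DoubleCode lam N' N :=
  Submodule.span F[X] {(a', a)}

namespace DoubleCode

variable {lam : Fˣ} {N' N : ℕ}

/-- The dimension over `F`. -/
noncomputable def dim (D : DoubleCode lam N' N) : ℕ :=
  Module.finrank F (D.restrictScalars F)

open Classical in
/-- The Hamming weight of the word of length `N' + N` given by a pair. -/
noncomputable def weight (c : Ambient lam N' × Ambient lam N) : ℕ :=
  hammingNorm (word c.1) + hammingNorm (word c.2)

/-- The minimum weight of the nonzero codewords, which for a linear code is the minimum distance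
(with the value `0` for the zero code, which has no nonzero codeword). -/
noncomputable def minWeight (D : DoubleCode lam N' N) : ℕ :=
  sInf {w | ∃ c ∈ D, c ≠ 0 ∧ weight c = w}

/-- The relative minimum distance: minimum distance divided by the code length `N' + N`. -/
noncomputable def relDist (D : DoubleCode lam N' N) : ℝ :=
  (minWeight D : ℝ) / ((N' : ℝ) + N)

end DoubleCode

/-- The probability of the event `P` in a finite sample space with equal probabilities. -/
noncomputable def uniformProb {Ω : Type*} (P : Ω → Prop) : ℝ :=
  (Nat.card {x : Ω // P x} : ℝ) / Nat.card Ω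

/-- The probability that the random code `C_{a',a}` has the property `P`, for `(a', a)` uniform in
`genIdeal lam k' n × genIdeal lam k n`. -/
noncomputable def codeProb (lam : Fˣ) (k' k n : ℕ)
    (P : DoubleCode lam (k' * n) (k * n) → Prop) : ℝ :=
  uniformProb fun x : genIdeal lam k' n × genIdeal lam k n =>
    P (oneGenCode (x.1 : Ambient lam (k' * n)) (x.2 : Ambient lam (k * n)))

end TwistedCode

section Window

variable {F A : Type*} [Field F] [CommRing A] [Algebra F A]

open Classical in
/-- The number of nonzero values of `m ↦ ℓ (x ^ m * a)` on the window `i ≤ m < i + d`. -/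
noncomputable def windowWeight (ℓ : A →ₗ[F] F) (x : A) (i d : ℕ) (a : A) : ℕ :=
  ((Finset.Ico i (i + d)).filter fun m => ℓ (x ^ m * a) ≠ 0).card

variable {ℓ : A →ₗ[F] F} {x : A} {r : F} {n : ℕ}

theorem map_pow_mul_of_periodic (hper : ∀ a, ℓ (x ^ n * a) = r * ℓ a) (k : ℕ) (a : A) :
    ℓ (x ^ (n * k) * a) = r ^ k * ℓ a := by
  induction k generalizing a with
  | zero => simp
  | succ k ih =>
    rw [mul_add, mul_one, pow_add, mul_assoc, ih, hper]
    ring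

theorem sum_windowWeight (hr : r ≠ 0) (hper : ∀ a, ℓ (x ^ n * a) = r * ℓ a) (d : ℕ) (a : A) :
    ∑ i ∈ Finset.range n, windowWeight ℓ x i d a = d * windowWeight ℓ x 0 n a := by
  classical
  have hp : Function.Periodic (fun m => ℓ (x ^ m * a) ≠ 0) n := by
    intro m
    have : ℓ (x ^ (m + n) * a) = r * ℓ (x ^ m * a) := by
      rw [add_comm, pow_add, mul_assoc, hper]
    simp [this, hr]
  have h1 : ∀ j, ∑ i ∈ Finset.range n, (if ℓ (x ^ (i + j) * a) ≠ 0 then 1 else 0)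
      = windowWeight ℓ x 0 n a := by
    intro j
    have e1 : ∑ i ∈ Finset.range n, (if ℓ (x ^ (i + j) * a) ≠ 0 then 1 else 0)
        = ((Finset.Ico j (j + n)).filter fun m => ℓ (x ^ m * a) ≠ 0).card := by
      rw [Finset.card_filter, Finset.sum_Ico_eq_sum_range]
      simp [add_comm]
    rw [e1, windowWeight, Nat.filter_Ico_card_eq_of_periodic _ _ _ hp,
      Nat.filter_Ico_card_eq_of_periodic _ _ _ hp]
  have h2 : ∀ i, windowWeight ℓ x i d a
      = ∑ j ∈ Finset.range d, (if ℓ (x ^ (i + j) * a) ≠ 0 then 1 else 0) := by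
    intro i
    rw [windowWeight, Finset.card_filter, Finset.sum_Ico_eq_sum_range]
    simp
  simp only [h2]
  rw [Finset.sum_comm]
  simp only [h1]
  simp

/-- A window whose length is the degree of a monic polynomial annihilating `a` determines `a`. -/
theorem eq_zero_of_window_eq_zero (hn : 0 < n) (hr : r ≠ 0)
    (hper : ∀ a, ℓ (x ^ n * a) = r * ℓ a)
    (hnd : ∀ a, (∀ m, ℓ (x ^ m * a) = 0) → a = 0) {e : F[X]} (he : e.Monic) {a : A}
    (hea : aeval x e * a = 0) (i : ℕ)
    (hw : ∀ j < e.natDegree, ℓ (x ^ (i + j) * a) = 0) : a = 0 := by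
  have key : ∀ j, ℓ (x ^ (i + j) * a) = 0 := by
    intro j
    induction j using Nat.strong_induction_on with
    | _ j ih =>
      by_cases hj : j < e.natDegree
      · exact hw j hj
      push Not at hj
      obtain ⟨b, rfl⟩ := Nat.exists_eq_add_of_le hj
      have h0 : ℓ (x ^ (i + b) * (aeval x e * a)) = 0 := by simp [hea]
      rw [aeval_eq_sum_range, Finset.sum_range_succ, he.coeff_natDegree, one_smul, add_mul,
        mul_add, map_add, Finset.sum_mul, Finset.mul_sum, map_sum, Finset.sum_eq_zero,
        zero_add] at h0
      · rw [← h0]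
        congr 1
        ring
      · intro c hc
        have := ih (b + c) (by have := Finset.mem_range.1 hc; omega)
        rw [smul_mul_assoc, mul_smul_comm, map_smul]
        have e2 : x ^ (i + b) * (x ^ c * a) = x ^ (i + (b + c)) * a := by ring
        rw [e2, this, smul_zero]
  refine hnd a fun m => ?_
  have h1 : ℓ (x ^ (n * i) * (x ^ m * a)) = 0 := by
    have hle : i ≤ n * i := Nat.le_mul_of_pos_left i hn
    have := key (n * i - i + m)
    rw [← mul_assoc, ← pow_add]
    convert this using 4
    omega
  rw [map_pow_mul_of_periodic hper] at h1
  exact (mul_eq_zero.1 h1).resolve_left (pow_ne_zero _ hr)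

theorem sum_pow_card_ne_zero [Fintype F] (θ : ℝ) (d : ℕ) [DecidableEq F] :
    ∑ v : Fin d → F, θ ^ (Finset.univ.filter fun j => v j ≠ 0).card
      = (1 + ((Fintype.card F : ℝ) - 1) * θ) ^ d := by
  have h : ∑ c : F, (if c ≠ 0 then θ else 1) = 1 + ((Fintype.card F : ℝ) - 1) * θ := by
    rw [← Finset.sum_filter_add_sum_filter_not _ (fun c : F => c ≠ 0)]
    rw [Finset.sum_congr rfl (g := fun _ => θ) (by intro c hc; simp_all)]
    rw [Finset.sum_congr (s₁ := Finset.univ.filter fun c : F => ¬ c ≠ 0) rfl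
      (g := fun _ => (1 : ℝ)) (by intro c hc; simp_all)]
    have h3 : (Finset.univ.filter fun c : F => ¬ c ≠ 0) = {0} := by ext; simp
    have h4 : (Finset.univ.filter fun c : F => c ≠ 0) = Finset.univ.erase 0 := by ext; simp
    rw [h3, h4]
    simp [Finset.card_erase_of_mem, Nat.cast_sub Fintype.card_pos]
    ring
  rw [← h, Fintype.sum_pow]
  refine Finset.sum_congr rfl fun v _ => ?_
  rw [Finset.prod_ite]
  simp

theorem windowWeight_eq_card [DecidableEq F] (i d : ℕ) (a : A) :
    windowWeight ℓ x i d a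
      = (Finset.univ.filter fun j : Fin d => ℓ (x ^ (i + j.val) * a) ≠ 0).card := by
  rw [windowWeight, Finset.card_filter, Finset.card_filter, Finset.sum_Ico_eq_sum_range,
    Nat.add_sub_cancel_left, Finset.sum_range]
  refine Finset.sum_congr rfl fun j _ => ?_
  congr

theorem sum_pow_windowWeight_mul_le [Fintype F] [Fintype A] [DecidableEq A] {θ : ℝ}
    (hθ : 0 ≤ θ) (h : A) (i d : ℕ)
    (hinj : ∀ f, (∀ j < d, ℓ (x ^ (i + j) * (h * f)) = 0) → h * f = 0) :
    ∑ f : A, θ ^ windowWeight ℓ x i d (h * f)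
      ≤ (Finset.univ.filter fun f : A => h * f = 0).card
        * (1 + ((Fintype.card F : ℝ) - 1) * θ) ^ d := by
  classical
  set T : A → (Fin d → F) := fun f j => ℓ (x ^ (i + j.val) * (h * f)) with hT
  have hfib : ∀ v, (Finset.univ.filter fun f => T f = v).card
      ≤ (Finset.univ.filter fun f : A => h * f = 0).card := by
    intro v
    rcases (Finset.univ.filter fun f => T f = v).eq_empty_or_nonempty with h0 | ⟨f₀, hf₀⟩
    · simp [h0]
    refine Finset.card_le_card_of_injOn (fun f => f - f₀) ?_ (fun a _ b _ hab => by simpa using hab)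
    intro f hf
    simp only [Finset.coe_filter, Finset.mem_univ, true_and, Set.mem_ofPred_eq,
      Finset.mem_filter] at hf hf₀ ⊢
    refine hinj _ fun j hj => ?_
    have := congrFun (hf.trans hf₀.symm) ⟨j, hj⟩
    simp only [hT] at this
    rw [mul_sub, mul_sub, map_sub, this, sub_self]
  calc ∑ f : A, θ ^ windowWeight ℓ x i d (h * f)
      = ∑ f : A, θ ^ (Finset.univ.filter fun j => T f j ≠ 0).card := by
        simp only [windowWeight_eq_card, hT]
    _ = ∑ v : Fin d → F, ∑ f ∈ Finset.univ.filter (fun f => T f = v),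
          θ ^ (Finset.univ.filter fun j => T f j ≠ 0).card :=
        (Finset.sum_fiberwise _ _ _).symm
    _ ≤ ∑ v : Fin d → F, (Finset.univ.filter fun f : A => h * f = 0).card
          * θ ^ (Finset.univ.filter fun j => v j ≠ 0).card := by
        refine Finset.sum_le_sum fun v _ => ?_
        rw [Finset.sum_congr rfl (g := fun _ => θ ^ (Finset.univ.filter fun j => v j ≠ 0).card)]
        · rw [Finset.sum_const, nsmul_eq_mul]
          exact mul_le_mul_of_nonneg_right (by exact_mod_cast hfib v) (by positivity)
        · intro f hf
          rw [(Finset.mem_filter.1 hf).2]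
    _ = _ := by rw [← Finset.mul_sum, sum_pow_card_ne_zero]

theorem card_filter_le_sum {α : Type*} [Fintype α] (P : α → Prop) [DecidablePred P] {g : α → ℝ}
    (h0 : ∀ a, 0 ≤ g a) (h1 : ∀ a, P a → 1 ≤ g a) :
    ((Finset.univ.filter P).card : ℝ) ≤ ∑ a, g a := by
  rw [Finset.card_filter]
  push_cast
  refine Finset.sum_le_sum fun a _ => ?_
  split_ifs with h
  exacts [h1 a h, h0 a]

/-- Some window carries at most the average share of the weight of a pair. -/
theorem exists_windowWeight_le (hn : 0 < n) (hr : r ≠ 0) (hper : ∀ a, ℓ (x ^ n * a) = r * ℓ a)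
    (d : ℕ) {η : ℝ} {a b : A}
    (hab : (windowWeight ℓ x 0 n a : ℝ) + windowWeight ℓ x 0 n b ≤ 2 * n * η) :
    ∃ i ∈ Finset.range n,
      (windowWeight ℓ x i d a : ℝ) + windowWeight ℓ x i d b ≤ 2 * d * η := by
  refine Finset.exists_le_of_sum_le (by simpa using hn.ne') ?_
  have h1 := sum_windowWeight hr hper d a
  have h2 := sum_windowWeight hr hper d b
  rw [Finset.sum_add_distrib, ← Nat.cast_sum, ← Nat.cast_sum, h1, h2, Nat.cast_mul, Nat.cast_mul,
    ← mul_add, Finset.sum_const, Finset.card_range, nsmul_eq_mul]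
  calc _ ≤ (d : ℝ) * (2 * n * η) := mul_le_mul_of_nonneg_left hab (by positivity)
    _ = _ := by ring

/-- Chernoff bound for the number of pairs `(f', f)` such that `(h f', h f)` has small weight. -/
theorem card_small_weight_le [Fintype F] [Fintype A] [DecidableEq A] (hn : 0 < n) (hr : r ≠ 0)
    (hper : ∀ a, ℓ (x ^ n * a) = r * ℓ a)
    (hnd : ∀ a, (∀ m, ℓ (x ^ m * a) = 0) → a = 0) {e : F[X]} (he : e.Monic) {h : A}
    (heh : aeval x e * h = 0) {θ η : ℝ} (hθ : 0 < θ) (hθ1 : θ ≤ 1) :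
    ((Finset.univ.filter fun p : A × A =>
      (windowWeight ℓ x 0 n (h * p.1) : ℝ) + windowWeight ℓ x 0 n (h * p.2) ≤ 2 * n * η).card : ℝ)
      ≤ n * ((Finset.univ.filter fun f : A => h * f = 0).card : ℝ) ^ 2
        * (θ ^ (-η) * (1 + ((Fintype.card F : ℝ) - 1) * θ)) ^ (2 * e.natDegree) := by
  obtain ⟨W, hW⟩ : ∃ W : ℕ → A → ℕ, ∀ i f, windowWeight ℓ x i e.natDegree (h * f) = W i f :=
    ⟨_, fun _ _ => rfl⟩
  have hinj : ∀ i f, (∀ j < e.natDegree, ℓ (x ^ (i + j) * (h * f)) = 0) → h * f = 0 := by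
    intro i f hf
    refine eq_zero_of_window_eq_zero hn hr hper hnd he ?_ i hf
    rw [← mul_assoc, heh, zero_mul]
  have hle : ∀ i, ∑ f : A, θ ^ W i f ≤ _ := fun i => by
    simpa only [hW] using sum_pow_windowWeight_mul_le hθ.le h i e.natDegree (hinj i)
  have hwin : ∀ p : A × A,
      (windowWeight ℓ x 0 n (h * p.1) : ℝ) + windowWeight ℓ x 0 n (h * p.2) ≤ 2 * n * η →
      ∃ i ∈ Finset.range n, (W i p.1 : ℝ) + W i p.2 ≤ 2 * e.natDegree * η := by
    intro p hp
    simpa only [hW] using exists_windowWeight_le hn hr hper e.natDegree hp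
  clear hinj hW
  generalize ((Finset.univ.filter fun f : A => h * f = 0).card : ℝ) = κ at hle ⊢
  generalize e.natDegree = d at hle hwin ⊢
  generalize 1 + ((Fintype.card F : ℝ) - 1) * θ = B at hle ⊢
  have hpos : ∀ (p : A × A) (i : ℕ),
      0 ≤ θ ^ (-(2 * d * η)) * (θ ^ W i p.1 * θ ^ W i p.2) := fun p i => by positivity
  have hsum : ∀ i, ∑ p : A × A, θ ^ (-(2 * d * η)) * (θ ^ W i p.1 * θ ^ W i p.2)
      ≤ θ ^ (-(2 * d * η)) * (κ * B ^ d) ^ 2 := by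
    intro i
    rw [← Finset.mul_sum, Fintype.sum_prod_type]
    simp only []
    rw [← Fintype.sum_mul_sum]
    have h0 : 0 ≤ ∑ f : A, θ ^ W i f := Finset.sum_nonneg fun _ _ => by positivity
    exact mul_le_mul_of_nonneg_left ((mul_self_le_mul_self h0 (hle i)).trans_eq (sq _).symm)
      (by positivity)
  refine (card_filter_le_sum _
    (g := fun p => ∑ i ∈ Finset.range n, θ ^ (-(2 * d * η)) * (θ ^ W i p.1 * θ ^ W i p.2))
    (fun p => Finset.sum_nonneg fun i _ => hpos p i) ?_).trans ?_
  · intro p hp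
    obtain ⟨i, hi, hi'⟩ := hwin p hp
    refine le_trans ?_ (Finset.single_le_sum (fun i _ => hpos p i) hi)
    rw [← pow_add, ← Real.rpow_natCast, ← Real.rpow_add hθ]
    refine Real.one_le_rpow_of_pos_of_le_one_of_nonpos hθ hθ1 ?_
    push_cast
    linarith
  · rw [Finset.sum_comm]
    refine (Finset.sum_le_sum fun i _ => hsum i).trans_eq ?_
    rw [Finset.sum_const, Finset.card_range, nsmul_eq_mul, mul_pow (θ ^ (-η)),
      ← Real.rpow_natCast (θ ^ (-η)), ← Real.rpow_mul hθ.le]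
    push_cast
    rw [show -η * (2 * (d : ℝ)) = -(2 * d * η) by ring, pow_mul' B]
    ring

end Window

section Divisors

variable {F : Type*} [Field F]

theorem finite_quotient_span [Finite F] {g : F[X]} (hg : g ≠ 0) :
    Finite (F[X] ⧸ Ideal.span {g}) := by
  have : Module.Finite F (F[X] ⧸ Ideal.span {g}) := by
    have : Module.Finite F (AdjoinRoot g) := (AdjoinRoot.powerBasis hg).finite
    exact this
  exact Module.finite_of_finite F

theorem card_quotient_span [Fintype F] {g : F[X]} (hg : g ≠ 0) :
    Nat.card (F[X] ⧸ Ideal.span {g}) = Fintype.card F ^ g.natDegree := by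
  have := finite_quotient_span hg
  rw [Module.natCard_eq_pow_finrank (K := F), Nat.card_eq_fintype_card,
    finrank_quotient_span_eq_natDegree]

/-- The multiples of `c` modulo `g` number at most `q ^ deg e` when `g ∣ c * e`. -/
theorem card_le_of_forall_exists_mul [Fintype F] {g c e : F[X]} (he : e ≠ 0) (hg : g ∣ c * e)
    (s : Finset (F[X] ⧸ Ideal.span {g}))
    (hs : ∀ x ∈ s, ∃ p, Ideal.Quotient.mk (Ideal.span {g}) (c * p) = x) :
    s.card ≤ Fintype.card F ^ e.natDegree := by
  classical
  have := finite_quotient_span he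
  have := Fintype.ofFinite (F[X] ⧸ Ideal.span {e})
  rw [← card_quotient_span he, Nat.card_eq_fintype_card]
  refine Finset.card_le_card_of_surjOn (s := Finset.univ)
    (fun x => Ideal.Quotient.mk (Ideal.span {g}) (c * Quotient.out x)) ?_
  intro x hx
  obtain ⟨p, rfl⟩ := hs x hx
  refine ⟨Ideal.Quotient.mk _ p, by simp, ?_⟩
  simp only
  rw [Ideal.Quotient.eq, ← mul_sub, Ideal.mem_span_singleton]
  refine hg.trans (mul_dvd_mul_left c ?_)
  rw [← Ideal.mem_span_singleton, ← Ideal.Quotient.eq]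
  exact Quotient.out_eq _

theorem sum_toFinset_powerset_erase_le {α : Type*} [DecidableEq α] (s : Multiset α) {f : α → ℝ}
    (hf : ∀ a, 0 ≤ f a) :
    ∑ t ∈ s.powerset.toFinset.erase 0, (t.map f).prod ≤ (s.map fun a => 1 + f a).prod - 1 := by
  have hnn : ∀ t : Multiset α, 0 ≤ (t.map f).prod := fun t =>
    Multiset.prod_nonneg (by simp only [Multiset.mem_map]; rintro _ ⟨a, _, rfl⟩; exact hf a)
  rw [Multiset.prod_map_add, Multiset.antidiagonal_eq_map_powerset, Multiset.map_map]
  simp only [Function.comp_def, Multiset.map_const', Multiset.prod_replicate, one_pow, one_mul]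
  rw [Finset.sum_multiset_map_count, le_sub_iff_add_le]
  have h0 : (0 : Multiset α) ∈ s.powerset.toFinset := by simp
  calc _ = ∑ t ∈ s.powerset.toFinset, (t.map f).prod := by
        rw [← Finset.sum_erase_add _ _ h0]; simp
    _ ≤ _ := by
        refine Finset.sum_le_sum fun t ht => ?_
        rw [nsmul_eq_mul]
        have : (1 : ℝ) ≤ s.powerset.count t := by
          exact_mod_cast Multiset.one_le_count_iff_mem.2 (Multiset.mem_toFinset.1 ht)
        exact le_mul_of_one_le_left (hnn t) this

open UniqueFactorizationMonoid

variable [DecidableEq F]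

theorem monic_of_mem_normalizedFactors {g p : F[X]} (hp : p ∈ normalizedFactors g) : p.Monic := by
  rw [← normalize_normalized_factor p hp]
  exact monic_normalize (ne_zero_of_mem_normalizedFactors hp)

theorem monic_prod_of_le_normalizedFactors {g : F[X]} {s : Multiset F[X]}
    (hs : s ≤ normalizedFactors g) : s.prod.Monic :=
  by
  simpa using monic_multiset_prod_of_monic s id fun _ hp =>
    monic_of_mem_normalizedFactors (Multiset.mem_of_le hs hp)

theorem pow_natDegree_prod {g : F[X]} {s : Multiset F[X]} (hs : s ≤ normalizedFactors g) (ρ : ℝ) :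
    ρ ^ s.prod.natDegree = (s.map fun p => ρ ^ p.natDegree).prod := by
  rw [natDegree_multiset_prod_of_monic _ fun _ hp =>
    monic_of_mem_normalizedFactors (Multiset.mem_of_le hs hp)]
  induction s using Multiset.induction_on with
  | empty => simp
  | cons a s ih =>
    simp [pow_add, ih ((Multiset.le_cons_self s a).trans hs)]

theorem card_normalizedFactors_le {g : F[X]} (hg : g ≠ 0) :
    (normalizedFactors g).card ≤ g.natDegree := by
  rw [← natDegree_eq_of_degree_eq (degree_eq_degree_of_associated (prod_normalizedFactors hg)),
    natDegree_multiset_prod_of_monic _ fun _ hp => monic_of_mem_normalizedFactors hp]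
  have := Multiset.card_nsmul_le_sum (s := (normalizedFactors g).map natDegree) (a := 1) (by
    simp only [Multiset.mem_map]
    rintro _ ⟨p, hp, rfl⟩
    exact (irreducible_of_normalized_factor p hp).natDegree_pos)
  simpa using this

/-- Annihilator data of a nonzero residue class `x` modulo `g`: a divisor `e` of `g` such that `x`
is a multiple of `g / e`, and the annihilator of `x` is generated by `e`. -/
theorem exists_annihilator_factors {g : F[X]} (hg : g ≠ 0) {x : F[X] ⧸ Ideal.span {g}}
    (hx : x ≠ 0) :
    ∃ s ≤ normalizedFactors g, s ≠ 0 ∧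
      Ideal.Quotient.mk (Ideal.span {g}) s.prod * x = 0 ∧
      (∃ p, Ideal.Quotient.mk (Ideal.span {g}) ((normalizedFactors g - s).prod * p) = x) ∧
      ∀ y, x * y = 0 → ∃ p, Ideal.Quotient.mk (Ideal.span {g}) (s.prod * p) = y := by
  obtain ⟨h, rfl⟩ := Ideal.Quotient.mk_surjective x
  have hgh : ¬ g ∣ h := by
    rwa [← Ideal.mem_span_singleton, ← Ideal.Quotient.eq_zero_iff_mem]
  let _ : GCDMonoid F[X] := UniqueFactorizationMonoid.toGCDMonoid _
  have hG : GCDMonoid.gcd g h ≠ 0 := gcd_ne_zero_of_left hg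
  obtain ⟨e, he⟩ := GCDMonoid.gcd_dvd_left g h
  obtain ⟨k, hk⟩ := GCDMonoid.gcd_dvd_right g h
  have hcop : IsCoprime e k := by
    have := isCoprime_div_gcd_div_gcd_of_gcd_ne_zero hG
    rwa [EuclideanDomain.div_eq_iff_eq_mul_of_dvd _ _ _ hG (GCDMonoid.gcd_dvd_left g h) |>.2 he,
      EuclideanDomain.div_eq_iff_eq_mul_of_dvd _ _ _ hG (GCDMonoid.gcd_dvd_right g h) |>.2 hk]
      at this
  generalize GCDMonoid.gcd g h = G at hG he hk
  have he0 : e ≠ 0 := by rintro rfl; simp at he; exact hg he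
  have hle : normalizedFactors e ≤ normalizedFactors g :=
    (dvd_iff_normalizedFactors_le_normalizedFactors he0 hg).1 (he ▸ dvd_mul_left _ _)
  have hea := prod_normalizedFactors he0
  have hsub : normalizedFactors g - normalizedFactors e = normalizedFactors G := by
    rw [he, normalizedFactors_mul hG he0]; simp
  refine ⟨normalizedFactors e, hle, ?_, ?_, ?_, ?_⟩
  · intro h0
    have hu : IsUnit e := by
      rw [h0, Multiset.prod_zero] at hea
      exact hea.isUnit isUnit_one
    refine hgh ?_
    rw [he, hk]
    exact mul_dvd_mul_left _ hu.dvd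
  · rw [← map_mul, Ideal.Quotient.eq_zero_iff_mem, Ideal.mem_span_singleton, he, hk, mul_left_comm]
    exact mul_dvd_mul_left _ (hea.symm.dvd.mul_right k)
  · obtain ⟨p, hp⟩ := ((prod_normalizedFactors hG).dvd.mul_right k)
    refine ⟨p, ?_⟩
    rw [hsub, ← hp, ← hk]
  · intro y hy
    obtain ⟨z, rfl⟩ := Ideal.Quotient.mk_surjective y
    rw [← map_mul, Ideal.Quotient.eq_zero_iff_mem, Ideal.mem_span_singleton, he, hk, mul_assoc]
      at hy
    have hez : e ∣ z := hcop.dvd_of_dvd_mul_left ((mul_dvd_mul_iff_left hG).1 hy)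
    obtain ⟨p, hp⟩ := hea.dvd.trans hez
    exact ⟨p, by rw [hp]⟩

theorem natDegree_prod_add_natDegree_prod_sub {g : F[X]} (hg : g ≠ 0) {s : Multiset F[X]}
    (hs : s ≤ normalizedFactors g) :
    Associated ((normalizedFactors g - s).prod * s.prod) g ∧
      (normalizedFactors g - s).prod.natDegree + s.prod.natDegree = g.natDegree := by
  have h1 : Associated ((normalizedFactors g - s).prod * s.prod) g := by
    rw [← Multiset.prod_add, tsub_add_cancel_of_le hs]
    exact prod_normalizedFactors hg
  refine ⟨h1, ?_⟩
  rw [← natDegree_eq_of_degree_eq (degree_eq_degree_of_associated h1), (monic_prod_of_le_normalizedFactors tsub_le_self).natDegree_mul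
    (monic_prod_of_le_normalizedFactors hs)]

open Classical in
/-- Union bound over all nonzero multipliers `h` modulo `g`, grouped by annihilator. -/
theorem card_exists_small_weight_le [Fintype F] {g : F[X]} (hg : g ≠ 0)
    [Fintype (F[X] ⧸ Ideal.span {g})]
    {ℓ : (F[X] ⧸ Ideal.span {g}) →ₗ[F] F} {r : F} {n μ : ℕ} (hn : 0 < n) (hr : r ≠ 0)
    (hper : ∀ a, ℓ (Ideal.Quotient.mk _ X ^ n * a) = r * ℓ a)
    (hnd : ∀ a, (∀ m, ℓ (Ideal.Quotient.mk _ X ^ m * a) = 0) → a = 0)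
    (hμ : ∀ p ∈ normalizedFactors g, μ ≤ p.natDegree) {θ η ρ : ℝ} (hθ : 0 < θ) (hθ1 : θ ≤ 1)
    (hρ : ρ = (θ ^ (-η) * (1 + ((Fintype.card F : ℝ) - 1) * θ)) ^ 2 / Fintype.card F)
    (hρ1 : ρ ≤ 1) :
    ((Finset.univ.filter fun p : (F[X] ⧸ Ideal.span {g}) × (F[X] ⧸ Ideal.span {g}) =>
      ∃ h, h ≠ 0 ∧ (windowWeight ℓ (Ideal.Quotient.mk _ X) 0 n (h * p.1) : ℝ)
        + windowWeight ℓ (Ideal.Quotient.mk _ X) 0 n (h * p.2) ≤ 2 * n * η).card : ℝ)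
      ≤ (Fintype.card (F[X] ⧸ Ideal.span {g}) : ℝ) ^ 2
        * (n * ((1 + ρ ^ μ) ^ g.natDegree - 1)) := by
  have hq0 : (0 : ℝ) < Fintype.card F := by exact_mod_cast Fintype.card_pos
  have hρ0 : 0 ≤ ρ := by rw [hρ]; positivity
  have hex : ∀ x : F[X] ⧸ Ideal.span {g}, ∃ s ≤ normalizedFactors g, (x ≠ 0 → s ≠ 0 ∧
      Ideal.Quotient.mk (Ideal.span {g}) s.prod * x = 0 ∧
      (∃ p, Ideal.Quotient.mk (Ideal.span {g}) ((normalizedFactors g - s).prod * p) = x) ∧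
      ∀ y, x * y = 0 → ∃ p, Ideal.Quotient.mk (Ideal.span {g}) (s.prod * p) = y) := by
    intro x
    by_cases hx : x = 0
    · exact ⟨0, zero_le, fun h => absurd hx h⟩
    · obtain ⟨s, hs, h⟩ := exists_annihilator_factors hg hx
      exact ⟨s, hs, fun _ => h⟩
  choose S hS hS' using hex
  have hcard : Fintype.card (F[X] ⧸ Ideal.span {g}) = Fintype.card F ^ g.natDegree := by
    rw [← card_quotient_span hg, Nat.card_eq_fintype_card]
  have hterm : ∀ h : F[X] ⧸ Ideal.span {g}, h ≠ 0 →
      ((Finset.univ.filter fun p : (F[X] ⧸ Ideal.span {g}) × (F[X] ⧸ Ideal.span {g}) =>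
      (windowWeight ℓ (Ideal.Quotient.mk _ X) 0 n (h * p.1) : ℝ)
        + windowWeight ℓ (Ideal.Quotient.mk _ X) 0 n (h * p.2) ≤ 2 * n * η).card : ℝ)
      ≤ (Fintype.card (F[X] ⧸ Ideal.span {g}) : ℝ) ^ 2 * n
        * (ρ / Fintype.card F) ^ (S h).prod.natDegree := by
    intro h hh
    obtain ⟨-, hann, -, hker⟩ := hS' h hh
    have hmon := monic_prod_of_le_normalizedFactors (hS h)
    obtain ⟨hass, hdeg⟩ := natDegree_prod_add_natDegree_prod_sub hg (hS h)
    have h1 := card_small_weight_le (x := Ideal.Quotient.mk (Ideal.span {g}) X) hn hr hper hnd hmon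
      (h := h) (η := η) (by
        have : aeval (Ideal.Quotient.mk (Ideal.span {g}) X) (S h).prod
            = Ideal.Quotient.mk (Ideal.span {g}) (S h).prod := by
          have := aeval_algebraMap_apply (F[X] ⧸ Ideal.span {g}) (X : F[X]) (S h).prod
          rwa [aeval_X_left_apply] at this
        rw [this, hann]) hθ hθ1
    have h2 : (Finset.univ.filter fun f => h * f = 0).card
        ≤ Fintype.card F ^ (normalizedFactors g - S h).prod.natDegree :=
      card_le_of_forall_exists_mul (c := (S h).prod)
        (monic_prod_of_le_normalizedFactors tsub_le_self).ne_zero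
        (by rw [mul_comm]; exact hass.symm.dvd) _ fun y hy => hker y (Finset.mem_filter.1 hy).2
    refine h1.trans ?_
    rw [pow_mul, hcard, ← hdeg]
    have h3 : (θ ^ (-η) * (1 + ((Fintype.card F : ℝ) - 1) * θ)) ^ 2 = ρ * Fintype.card F := by
      rw [hρ, div_mul_cancel₀ _ hq0.ne']
    rw [h3]
    calc _ ≤ (n : ℝ) * ((Fintype.card F ^ (normalizedFactors g - S h).prod.natDegree : ℕ) : ℝ) ^ 2
          * (ρ * Fintype.card F) ^ (S h).prod.natDegree :=
          mul_le_mul_of_nonneg_right (mul_le_mul_of_nonneg_left (pow_le_pow_left₀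
            (Nat.cast_nonneg _) (Nat.cast_le.2 h2) 2) (Nat.cast_nonneg _))
            (pow_nonneg (mul_nonneg hρ0 hq0.le) _)
      _ = _ := by
        push_cast
        rw [pow_add, div_pow, mul_pow]
        field_simp
  have hsum : ∑ h ∈ Finset.univ.filter (fun h : F[X] ⧸ Ideal.span {g} => h ≠ 0),
      (ρ / Fintype.card F) ^ (S h).prod.natDegree ≤ (1 + ρ ^ μ) ^ g.natDegree - 1 := by
    have hmaps : ∀ h ∈ Finset.univ.filter (fun h : F[X] ⧸ Ideal.span {g} => h ≠ 0),
        S h ∈ (normalizedFactors g).powerset.toFinset.erase 0 := by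
      intro h hh
      have hh' := (Finset.mem_filter.1 hh).2
      simp [(hS' h hh').1, hS h]
    rw [← Finset.sum_fiberwise_of_maps_to hmaps]
    calc _ ≤ ∑ s ∈ (normalizedFactors g).powerset.toFinset.erase 0,
            (s.map fun p => ρ ^ p.natDegree).prod := by
          refine Finset.sum_le_sum fun s hs => ?_
          have hs' : s ≤ normalizedFactors g := by
            simpa using (Finset.mem_erase.1 hs).2
          rw [Finset.sum_congr rfl (g := fun _ => (ρ / Fintype.card F) ^ s.prod.natDegree)
            (fun h hh => by rw [(Finset.mem_filter.1 hh).2]), Finset.sum_const, nsmul_eq_mul,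
            ← pow_natDegree_prod hs']
          have hle := card_le_of_forall_exists_mul (c := (normalizedFactors g - s).prod)
            (monic_prod_of_le_normalizedFactors hs').ne_zero
            (natDegree_prod_add_natDegree_prod_sub hg hs').1.symm.dvd
            ((Finset.univ.filter (fun h : F[X] ⧸ Ideal.span {g} => h ≠ 0)).filter
              fun h => S h = s) (by
              intro x hx
              simp only [Finset.mem_filter, Finset.mem_univ, true_and] at hx
              obtain ⟨hx0, rfl⟩ := hx
              exact (hS' x hx0).2.2.1)
          calc _ ≤ ((Fintype.card F ^ s.prod.natDegree : ℕ) : ℝ)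
                * (ρ / Fintype.card F) ^ s.prod.natDegree := by gcongr
            _ = _ := by
              push_cast
              rw [← mul_pow, mul_div_cancel₀ _ hq0.ne']
      _ ≤ ((normalizedFactors g).map fun p => 1 + ρ ^ p.natDegree).prod - 1 :=
          sum_toFinset_powerset_erase_le _ fun _ => by positivity
      _ ≤ ((normalizedFactors g).map fun _ => 1 + ρ ^ μ).prod - 1 := by
          gcongr ?_ - 1
          refine Multiset.prod_map_le_prod_map₀ _ _ (fun p _ => by positivity) fun p hp => ?_
          gcongr 1 + ?_
          exact pow_le_pow_of_le_one hρ0 hρ1 (hμ p hp)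
      _ ≤ _ := by
          rw [Multiset.map_const', Multiset.prod_replicate]
          gcongr
          · linarith [pow_nonneg hρ0 μ]
          · exact card_normalizedFactors_le hg
  refine (Nat.cast_le.2 (Finset.card_le_card (t := (Finset.univ.filter
    (fun h : F[X] ⧸ Ideal.span {g} => h ≠ 0)).biUnion fun h => Finset.univ.filter
    fun p : (F[X] ⧸ Ideal.span {g}) × (F[X] ⧸ Ideal.span {g}) =>
      (windowWeight ℓ (Ideal.Quotient.mk _ X) 0 n (h * p.1) : ℝ)
        + windowWeight ℓ (Ideal.Quotient.mk _ X) 0 n (h * p.2) ≤ 2 * n * η) ?_)).trans ?_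
  · intro p hp
    obtain ⟨h, hh, hw⟩ := (Finset.mem_filter.1 hp).2
    exact Finset.mem_biUnion.2 ⟨h, by simpa using hh, by simpa using hw⟩
  · refine (Nat.cast_le.2 Finset.card_biUnion_le).trans ?_
    push_cast
    refine (Finset.sum_le_sum fun h hh => hterm h (Finset.mem_filter.1 hh).2).trans ?_
    rw [← Finset.mul_sum, mul_assoc]
    gcongr

end Divisors

namespace TwistedCode

variable {F : Type*} [Field F]

theorem coeff_X_pow_mul_modByMonic {n : ℕ} (hn : 0 < n) (r : F) {u : F[X]}
    (hu : u.degree < n) (m j : ℕ) (hm : m ≤ j) (hj : j < n) :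
    ((X ^ m * u) %ₘ (X ^ n - C r)).coeff j = u.coeff (j - m) := by
  have hP : (X ^ n - C r : F[X]).Monic := monic_X_pow_sub_C _ hn.ne'
  have hdeg : (X ^ n - C r : F[X]).degree = n := degree_X_pow_sub_C hn _
  have step : ∀ v : F[X], v.degree < n → ∀ j, j + 1 < n →
      ((X * v) %ₘ (X ^ n - C r)).coeff (j + 1) = v.coeff j := by
    intro v hv j hj
    have h1 : (X * v - C (v.coeff (n - 1)) * (X ^ n - C r)).degree < (n : WithBot ℕ) := by
      rw [degree_lt_iff_coeff_zero]
      intro t ht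
      obtain ⟨t, rfl⟩ : ∃ t', t = t' + 1 := ⟨t - 1, by omega⟩
      simp only [coeff_sub, coeff_X_mul, coeff_C_mul, coeff_X_pow, coeff_C_succ, sub_zero]
      rcases ht.eq_or_lt with h | h
      · simp [h]
      · rw [if_neg h.ne', (degree_lt_iff_coeff_zero _ _).1 hv t (by omega)]
        simp
    rw [(div_modByMonic_unique (C (v.coeff (n - 1)))
      (X * v - C (v.coeff (n - 1)) * (X ^ n - C r)) hP ⟨by ring, by rwa [hdeg]⟩).2]
    simp only [coeff_sub, coeff_X_mul, coeff_C_mul, coeff_X_pow, coeff_C_succ, sub_zero]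
    rw [if_neg hj.ne]
    simp
  induction m generalizing j with
  | zero =>
    rw [pow_zero, one_mul, (modByMonic_eq_self_iff hP).2 (by rwa [hdeg]), Nat.sub_zero]
  | succ m ih =>
    obtain ⟨j, rfl⟩ : ∃ j', j = j' + 1 := ⟨j - 1, by omega⟩
    have h2 : (X ^ (m + 1) * u) %ₘ (X ^ n - C r)
        = (X * ((X ^ m * u) %ₘ (X ^ n - C r))) %ₘ (X ^ n - C r) := by
      refine modByMonic_eq_of_dvd_sub hP ?_
      have h3 := modByMonic_add_div (X ^ m * u) (X ^ n - C r)
      refine ⟨X * ((X ^ m * u) /ₘ (X ^ n - C r)), ?_⟩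
      linear_combination (-X : F[X]) * h3
    rw [h2, step _ ((degree_modByMonic_lt _ hP).trans_eq hdeg) _ hj, ih j (by omega) (by omega)]
    congr 1
    omega

/-- The polynomial `1 + c X + ⋯ + (c X) ^ (n - 1)`. -/
noncomputable def scaledGeom (c : F) (n : ℕ) : F[X] :=
  ∑ j ∈ Finset.range n, (C c * X) ^ j

section Scaled

variable {c r : F} {n : ℕ}

theorem scaledGeom_mul (hcr : c ^ n * r = 1) :
    scaledGeom c n * (C c * X - 1) = C (c ^ n) * (X ^ n - C r) := by
  rw [scaledGeom, geom_sum_mul, mul_sub, ← C_mul, hcr, mul_pow, C_1, C_pow]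

theorem natDegree_scaledGeom (hc : c ≠ 0) (hcr : c ^ n * r = 1) (hn : 0 < n) :
    (scaledGeom c n).natDegree = n - 1 ∧ scaledGeom c n ≠ 0 := by
  have h := scaledGeom_mul hcr
  have hP : (X ^ n - C r : F[X]).Monic := monic_X_pow_sub_C _ hn.ne'
  have hlin : (C c * X - 1 : F[X]).natDegree = 1 := by
    simpa [sub_eq_add_neg] using natDegree_linear (a := c) (b := -1) hc
  have h0 : scaledGeom c n ≠ 0 := by
    intro h0
    rw [h0, zero_mul] at h
    exact mul_ne_zero (C_ne_zero.2 (pow_ne_zero _ hc)) hP.ne_zero h.symm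
  refine ⟨?_, h0⟩
  have h2 := congrArg natDegree h
  rw [natDegree_mul h0 (by rintro h; simp [h] at hlin), hlin,
    natDegree_C_mul (pow_ne_zero _ hc), natDegree_X_pow_sub_C] at h2
  omega

theorem dvd_mul_iff_scaledGeom_dvd (hc : c ≠ 0) (hcr : c ^ n * r = 1) (f : F[X]) :
    X ^ n - C r ∣ f * (C c * X - 1) ↔ scaledGeom c n ∣ f := by
  have hu : IsUnit (C (c ^ n) : F[X]) := isUnit_C.2 (pow_ne_zero _ hc).isUnit
  have hlin : (C c * X - 1 : F[X]) ≠ 0 := by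
    intro h
    have := congrArg (fun p => coeff p 1) h
    simp [coeff_one, hc] at this
  rw [← hu.mul_left_dvd, ← scaledGeom_mul hcr, mul_dvd_mul_iff_right hlin]

/-- The residue of `f * (c X - 1)` modulo `X ^ n - r`. -/
noncomputable def residue (c r : F) (n : ℕ) (f : F[X]) : F[X] :=
  (f * (C c * X - 1)) %ₘ (X ^ n - C r)

theorem degree_residue_lt (hn : 0 < n) (f : F[X]) : (residue c r n f).degree < n :=
  (degree_modByMonic_lt _ (monic_X_pow_sub_C _ hn.ne')).trans_eq (degree_X_pow_sub_C hn _)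

theorem residue_add (f f' : F[X]) :
    residue c r n (f + f') = residue c r n f + residue c r n f' := by
  rw [residue, add_mul, add_modByMonic]; rfl

theorem residue_C_mul (a : F) (f : F[X]) : residue c r n (C a * f) = C a * residue c r n f := by
  rw [residue, mul_assoc, ← smul_eq_C_mul, smul_modByMonic, smul_eq_C_mul]; rfl

theorem residue_eq_of_dvd (hc : c ≠ 0) (hcr : c ^ n * r = 1) (hn : 0 < n) {f f' : F[X]}
    (h : scaledGeom c n ∣ f - f') : residue c r n f = residue c r n f' := by
  refine modByMonic_eq_of_dvd_sub (monic_X_pow_sub_C _ hn.ne') ?_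
  rw [← sub_mul, dvd_mul_iff_scaledGeom_dvd hc hcr]
  exact h

theorem residue_X_pow_mul (hn : 0 < n) (f : F[X]) :
    residue c r n (X ^ n * f) = C r * residue c r n f := by
  rw [← residue_C_mul]
  refine modByMonic_eq_of_dvd_sub (monic_X_pow_sub_C _ hn.ne') ?_
  exact ⟨f * (C c * X - 1), by ring⟩

theorem coeff_residue_X_pow_mul (hn : 0 < n) (f : F[X]) {m : ℕ} (hm : m < n) :
    (residue c r n (X ^ m * f)).coeff (n - 1) = (residue c r n f).coeff (n - 1 - m) := by
  rw [← coeff_X_pow_mul_modByMonic hn r (degree_residue_lt hn f) m (n - 1) (by omega) (by omega)]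
  congr 1
  refine modByMonic_eq_of_dvd_sub (monic_X_pow_sub_C _ hn.ne') ?_
  have h3 := modByMonic_add_div (f * (C c * X - 1)) (X ^ n - C r)
  refine ⟨X ^ m * ((f * (C c * X - 1)) /ₘ (X ^ n - C r)), ?_⟩
  rw [residue]
  linear_combination (-X ^ m : F[X]) * h3

/-- The residue ring of polynomials modulo `1 + c X + ⋯ + (c X) ^ (n - 1)`. -/
abbrev GeomQuot (c : F) (n : ℕ) : Type _ := F[X] ⧸ Ideal.span {scaledGeom c n}

theorem residue_out (hc : c ≠ 0) (hcr : c ^ n * r = 1) (hn : 0 < n) (f : F[X]) :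
    residue c r n (Quotient.out (Ideal.Quotient.mk (Ideal.span {scaledGeom c n}) f))
      = residue c r n f := by
  refine residue_eq_of_dvd hc hcr hn ?_
  rw [← Ideal.mem_span_singleton, ← Ideal.Quotient.eq]
  exact Quotient.out_eq _

/-- The top coefficient of the residue, as a functional on residue classes. -/
noncomputable def topCoeff (hc : c ≠ 0) (hcr : c ^ n * r = 1) (hn : 0 < n) :
    GeomQuot c n →ₗ[F] F where
  toFun a := (residue c r n (Quotient.out a)).coeff (n - 1)
  map_add' a b := by
    obtain ⟨f, rfl⟩ := Ideal.Quotient.mk_surjective a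
    obtain ⟨f', rfl⟩ := Ideal.Quotient.mk_surjective b
    rw [← map_add, residue_out hc hcr hn, residue_out hc hcr hn, residue_out hc hcr hn,
      residue_add, coeff_add]
  map_smul' t a := by
    obtain ⟨f, rfl⟩ := Ideal.Quotient.mk_surjective a
    have : t • Ideal.Quotient.mk (Ideal.span {scaledGeom c n}) f
        = Ideal.Quotient.mk (Ideal.span {scaledGeom c n}) (C t * f) := by
      rw [← smul_eq_C_mul]; rfl
    rw [this, residue_out hc hcr hn, residue_out hc hcr hn, residue_C_mul, coeff_C_mul]
    rfl

variable (hc : c ≠ 0) (hcr : c ^ n * r = 1) (hn : 0 < n)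

theorem topCoeff_mk (f : F[X]) :
    topCoeff hc hcr hn (Ideal.Quotient.mk _ f) = (residue c r n f).coeff (n - 1) :=
  congrArg (fun p => coeff p (n - 1)) (residue_out hc hcr hn f)

theorem topCoeff_pow_mul {m : ℕ} (hm : m < n) (f : F[X]) :
    topCoeff hc hcr hn (Ideal.Quotient.mk _ X ^ m * Ideal.Quotient.mk _ f)
      = (residue c r n f).coeff (n - 1 - m) := by
  rw [← map_pow, ← map_mul, topCoeff_mk, coeff_residue_X_pow_mul hn f hm]

theorem topCoeff_periodic (a : GeomQuot c n) :
    topCoeff hc hcr hn (Ideal.Quotient.mk _ X ^ n * a) = r * topCoeff hc hcr hn a := by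
  obtain ⟨f, rfl⟩ := Ideal.Quotient.mk_surjective a
  rw [← map_pow, ← map_mul, topCoeff_mk, topCoeff_mk, residue_X_pow_mul hn, coeff_C_mul]

theorem eq_zero_of_topCoeff_eq_zero (a : GeomQuot c n)
    (ha : ∀ m, topCoeff hc hcr hn (Ideal.Quotient.mk _ X ^ m * a) = 0) : a = 0 := by
  obtain ⟨f, rfl⟩ := Ideal.Quotient.mk_surjective a
  have h0 : residue c r n f = 0 := by
    ext j
    rw [coeff_zero]
    by_cases hj : j < n
    · have := ha (n - 1 - j)
      rw [topCoeff_pow_mul hc hcr hn (by omega)] at this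
      rwa [show n - 1 - (n - 1 - j) = j by omega] at this
    · exact (degree_lt_iff_coeff_zero _ _).1 (degree_residue_lt hn f) j (by omega)
  rw [Ideal.Quotient.eq_zero_iff_mem, Ideal.mem_span_singleton,
    ← dvd_mul_iff_scaledGeom_dvd hc hcr]
  exact (modByMonic_eq_zero_iff_dvd (monic_X_pow_sub_C _ hn.ne')).1 h0

theorem windowWeight_topCoeff [DecidableEq F] (f : F[X]) :
    windowWeight (topCoeff hc hcr hn) (Ideal.Quotient.mk _ X) 0 n (Ideal.Quotient.mk _ f)
      = (Finset.univ.filter fun j : Fin n => (residue c r n f).coeff j ≠ 0).card := by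
  rw [windowWeight_eq_card]
  refine Finset.card_equiv Fin.revPerm fun j => ?_
  simp only [Finset.mem_filter, Finset.mem_univ, true_and, Fin.revPerm_apply, Fin.val_rev,
    zero_add]
  rw [topCoeff_pow_mul hc hcr hn j.2, show n - 1 - j.val = n - (j.val + 1) by omega]

end Scaled

section Word

variable {lam : Fˣ} {k n : ℕ} {c r : F}

theorem psi_eq (hr : (unitRoot lam k : F) = r) :
    psi lam k n = ∑ i ∈ Finset.range k, C (r ^ (k - 1 - i)) * X ^ (n * i) := by
  rw [psi, ← Finset.sum_range_reflect]
  refine Finset.sum_congr rfl fun j hj => ?_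
  have hj := Finset.mem_range.1 hj
  rw [hr, ← pow_mul, C_pow, mul_comm, show k - 1 - (k - 1 - j) = j by omega]

theorem sub_mul_psi (hr : (unitRoot lam k : F) = r) (hrk : r ^ k = lam) :
    (X ^ n - C r) * psi lam k n = X ^ (k * n) - C (lam : F) := by
  have h := geom_sum₂_mul (C r) (X ^ n : F[X]) k
  have h1 : psi lam k n = ∑ i ∈ Finset.range k, C r ^ i * (X ^ n) ^ (k - 1 - i) := by
    rw [psi]
    exact Finset.sum_congr rfl fun j _ => by rw [hr, mul_comm]
  rw [h1, ← hrk, C_pow, mul_comm k n, pow_mul]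
  linear_combination -h

theorem psi_ne_zero (hk : 0 < k) (hn : 0 < n) (hr : (unitRoot lam k : F) = r)
    (hrk : r ^ k = lam) : psi lam k n ≠ 0 := by
  intro h
  have h1 := sub_mul_psi (n := n) hr hrk
  rw [h, mul_zero] at h1
  exact (monic_X_pow_sub_C (lam : F) (Nat.mul_pos hk hn).ne').ne_zero h1.symm

theorem coeff_mul_psi (hr : (unitRoot lam k : F) = r) {u : F[X]}
    (hu : u.degree < n) {a b : ℕ} (ha : a < k) (hb : b < n) :
    (u * psi lam k n).coeff (b + n * a) = r ^ (k - 1 - a) * u.coeff b := by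
  rw [psi_eq hr, Finset.mul_sum, finsetSum_coeff, Finset.sum_eq_single a]
  · rw [mul_left_comm, coeff_C_mul, coeff_mul_X_pow]
  · intro i _ hia
    rw [mul_left_comm, coeff_C_mul, coeff_mul_X_pow']
    split_ifs with hle
    · rcases lt_or_gt_of_ne hia with h | h
      · obtain ⟨t, rfl⟩ := Nat.exists_eq_add_of_lt h
        rw [(degree_lt_iff_coeff_zero _ _).1 hu, mul_zero]
        rw [show b + n * (i + t + 1) = n + (b + n * t) + n * i by ring, Nat.add_sub_cancel]
        omega
      · obtain ⟨t, rfl⟩ := Nat.exists_eq_add_of_lt h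
        exfalso
        have : n * (a + t + 1) = n * a + n * t + n := by ring
        have : 0 ≤ n * t := Nat.zero_le _
        omega
    · exact mul_zero _
  · intro h
    exact absurd (Finset.mem_range.2 ha) h

theorem degree_mul_psi_lt (hk : 0 < k) (hr : (unitRoot lam k : F) = r) {u : F[X]}
    (hu : u.degree < n) : (u * psi lam k n).degree < ((k * n : ℕ) : WithBot ℕ) := by
  by_cases h0 : u = 0
  · simp only [h0, zero_mul, degree_zero]; exact WithBot.bot_lt_coe _
  have h1 : (psi lam k n).natDegree ≤ n * (k - 1) := by
    rw [psi_eq hr]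
    refine natDegree_sum_le_of_forall_le _ _ fun i hi => (natDegree_C_mul_X_pow_le _ _).trans ?_
    exact Nat.mul_le_mul_left _ (by have := Finset.mem_range.1 hi; omega)
  have h2 : u.natDegree < n := (natDegree_lt_iff_degree_lt h0).2 hu
  refine degree_le_natDegree.trans_lt (Nat.cast_lt.2 ?_)
  refine (natDegree_mul_le).trans_lt ?_
  obtain ⟨t, rfl⟩ : ∃ t, k = t + 1 := ⟨k - 1, by omega⟩
  simp only [Nat.add_sub_cancel] at h1
  have : (t + 1) * n = n * t + n := by ring
  omega

theorem word_mul_psiPlus (hk : 0 < k) (hn : 0 < n) (hr : (unitRoot lam k : F) = r)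
    (hrk : r ^ k = lam) (hc : (((unitRoot lam (k * n))⁻¹ : Fˣ) : F) = c) (f : F[X])
    (j : Fin (k * n)) :
    word (Ideal.Quotient.mk _ (f * psiPlus lam k n) : Ambient lam (k * n)) j
      = (residue c r n f * psi lam k n).coeff j := by
  have hN := (Nat.mul_pos hk hn)
  have hP : (X ^ (k * n) - C (lam : F) : F[X]).Monic := monic_X_pow_sub_C _ hN.ne'
  rw [word_mk hN.ne']
  congr 1
  refine (div_modByMonic_unique ((f * (C c * X - 1)) /ₘ (X ^ n - C r)) _ hP ⟨?_, ?_⟩).2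
  · rw [← sub_mul_psi hr hrk, psiPlus, hc, residue]
    have h3 := modByMonic_add_div (f * (C c * X - 1)) (X ^ n - C r)
    linear_combination (psi lam k n) * h3
  · rw [degree_X_pow_sub_C hN]
    exact degree_mul_psi_lt hk hr (degree_residue_lt hn f)

theorem hammingNorm_word [DecidableEq F] (hk : 0 < k) (hn : 0 < n)
    (hr : (unitRoot lam k : F) = r) (hrk : r ^ k = lam)
    (hc : (((unitRoot lam (k * n))⁻¹ : Fˣ) : F) = c) (f : F[X]) :
    hammingNorm (word (Ideal.Quotient.mk _ (f * psiPlus lam k n) : Ambient lam (k * n)))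
      = k * (Finset.univ.filter fun j : Fin n => (residue c r n f).coeff j ≠ 0).card := by
  have hr0 : r ≠ 0 := by rw [← hr]; exact Units.ne_zero _
  have h1 : k * (Finset.univ.filter fun j : Fin n => (residue c r n f).coeff j ≠ 0).card
      = ((Finset.univ : Finset (Fin k)) ×ˢ
        (Finset.univ.filter fun j : Fin n => (residue c r n f).coeff j ≠ 0)).card := by
    simp
  rw [h1, hammingNorm]
  refine (Finset.card_equiv finProdFinEquiv fun p => ?_).symm
  simp only [Finset.mem_product, Finset.mem_filter, Finset.mem_univ, true_and]
  rw [word_mul_psiPlus hk hn hr hrk hc, finProdFinEquiv_apply_val,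
    coeff_mul_psi hr (degree_residue_lt hn f) p.1.2 p.2.2]
  simp [hr0]

end Word

end TwistedCode

namespace TwistedCode

variable {F : Type*} [Field F]

/-- The relations between the roots `r = lam ^ (1/k)` and `c = lam ^ (-1/(k n))`. -/
structure IsRootPair (lam : Fˣ) (k n : ℕ) (c r : F) : Prop where
  k_pos : 0 < k
  n_pos : 0 < n
  unitRoot_eq : (unitRoot lam k : F) = r
  pow_eq : r ^ k = lam
  inv_unitRoot_eq : (((unitRoot lam (k * n))⁻¹ : Fˣ) : F) = c
  pow_mul_eq : c ^ n * r = 1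

theorem unitRoot_mul_pow [Finite F] (lam : Fˣ) {k n : ℕ} (hk : k.Coprime (orderOf lam))
    (hn : n.Coprime (orderOf lam)) :
    unitRoot lam (k * n) ^ n = unitRoot lam k := by
  have : NeZero (orderOf lam) := ⟨(orderOf_pos lam).ne'⟩
  rw [unitRoot, unitRoot, ← pow_mul, pow_eq_pow_iff_modEq, ← ZMod.natCast_eq_natCast_iff]
  push_cast
  rw [ZMod.natCast_zmod_val, ZMod.natCast_zmod_val]
  have h1 := ZMod.coe_mul_inv_eq_one k hk
  have h2 := ZMod.coe_mul_inv_eq_one (k * n) (hk.mul_left hn)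
  push_cast at h2
  linear_combination (k : ZMod (orderOf lam))⁻¹ * h2
    - ((k : ZMod (orderOf lam)) * n)⁻¹ * n * h1

theorem unitRoot_congr {lam : Fˣ} {k k' : ℕ} (h : k' ≡ k [MOD orderOf lam]) :
    unitRoot lam k' = unitRoot lam k := by
  rw [unitRoot, unitRoot, (ZMod.natCast_eq_natCast_iff _ _ _).2 h]

theorem isRootPair [Finite F] {lam : Fˣ} {k n : ℕ} (hk : 0 < k) (hn : 0 < n)
    (hkc : k.Coprime (orderOf lam)) (hnc : n.Coprime (orderOf lam)) :
    IsRootPair lam k n (((unitRoot lam (k * n))⁻¹ : Fˣ) : F) (unitRoot lam k : F) where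
  k_pos := hk
  n_pos := hn
  unitRoot_eq := rfl
  pow_eq := by rw [← Units.val_pow_eq_pow_val, unitRoot_pow lam k hkc]
  inv_unitRoot_eq := rfl
  pow_mul_eq := by
    rw [← Units.val_pow_eq_pow_val, inv_pow, unitRoot_mul_pow lam hkc hnc, ← Units.val_mul,
      inv_mul_cancel, Units.val_one]

namespace IsRootPair

variable {lam : Fˣ} {k k' n : ℕ} {c r : F}

theorem ne_zero_left (h : IsRootPair lam k n c r) : c ≠ 0 := by
  rw [← h.inv_unitRoot_eq]; exact Units.ne_zero _

theorem ne_zero_right (h : IsRootPair lam k n c r) : r ≠ 0 := by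
  rw [← h.unitRoot_eq]; exact Units.ne_zero _

theorem mk_mul_psiPlus_eq_zero_iff (h : IsRootPair lam k n c r) (f : F[X]) :
    (Ideal.Quotient.mk _ (f * psiPlus lam k n) : Ambient lam (k * n)) = 0
      ↔ scaledGeom c n ∣ f := by
  rw [Ideal.Quotient.eq_zero_iff_mem, Ideal.mem_span_singleton,
    ← sub_mul_psi h.unitRoot_eq h.pow_eq, psiPlus, h.inv_unitRoot_eq, ← mul_assoc,
    mul_dvd_mul_iff_right (psi_ne_zero h.k_pos h.n_pos h.unitRoot_eq h.pow_eq),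
    dvd_mul_iff_scaledGeom_dvd h.ne_zero_left h.pow_mul_eq]

/-- The embedding `f ↦ f ψ⁺` of the residue ring onto the ideal generated by `ψ⁺`. -/
noncomputable def genMap (h : IsRootPair lam k n c r) :
    GeomQuot c n →ₗ[F[X]] Ambient lam (k * n) :=
  Submodule.liftQ _ (LinearMap.toSpanSingleton F[X] (Ambient lam (k * n))
    (Ideal.Quotient.mk _ (psiPlus lam k n))) (by
      intro f hf
      rw [LinearMap.mem_ker, LinearMap.toSpanSingleton_apply]
      exact (h.mk_mul_psiPlus_eq_zero_iff f).2 (Ideal.mem_span_singleton.1 hf))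

theorem genMap_mk (h : IsRootPair lam k n c r) (f : F[X]) :
    h.genMap (Ideal.Quotient.mk _ f) = Ideal.Quotient.mk _ (f * psiPlus lam k n) := rfl

theorem genMap_injective (h : IsRootPair lam k n c r) : Function.Injective h.genMap := by
  rw [injective_iff_map_eq_zero]
  intro a ha
  obtain ⟨f, rfl⟩ := Ideal.Quotient.mk_surjective a
  rw [genMap_mk, h.mk_mul_psiPlus_eq_zero_iff] at ha
  rwa [Ideal.Quotient.eq_zero_iff_mem, Ideal.mem_span_singleton]

/-- The bijection between the residue ring and the ideal generated by `ψ⁺`. -/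
noncomputable def genEquiv (h : IsRootPair lam k n c r) : GeomQuot c n ≃ genIdeal lam k n :=
  Equiv.ofBijective (fun a => ⟨h.genMap a, by
    obtain ⟨f, rfl⟩ := Ideal.Quotient.mk_surjective a
    rw [genMap_mk, map_mul]
    exact Ideal.mul_mem_left _ _ (Ideal.mem_span_singleton_self _)⟩)
    ⟨fun a b hab => h.genMap_injective (congrArg Subtype.val hab), fun ⟨y, hy⟩ => by
      obtain ⟨z, hz⟩ := Ideal.mem_span_singleton'.1 hy
      obtain ⟨f, rfl⟩ := Ideal.Quotient.mk_surjective z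
      refine ⟨Ideal.Quotient.mk _ f, Subtype.ext ?_⟩
      simp only [genMap_mk]
      rw [map_mul, hz]⟩

/-- The weight of a residue class: the number of nonzero coefficients of its residue. -/
noncomputable def residueWeight (h : IsRootPair lam k n c r) : GeomQuot c n → ℕ :=
  windowWeight (topCoeff h.ne_zero_left h.pow_mul_eq h.n_pos) (Ideal.Quotient.mk _ X) 0 n

theorem residueWeight_eq (h : IsRootPair lam k n c r) (h' : IsRootPair lam k' n c r) :
    h.residueWeight = h'.residueWeight := rfl

theorem hammingNorm_genMap [DecidableEq F] (h : IsRootPair lam k n c r) (a : GeomQuot c n) :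
    hammingNorm (word (h.genMap a)) = k * h.residueWeight a := by
  obtain ⟨f, rfl⟩ := Ideal.Quotient.mk_surjective a
  rw [genMap_mk, hammingNorm_word h.k_pos h.n_pos h.unitRoot_eq h.pow_eq h.inv_unitRoot_eq,
    residueWeight, windowWeight_topCoeff]

theorem weight_genMap (h : IsRootPair lam k n c r) (h' : IsRootPair lam k' n c r)
    (a' a : GeomQuot c n) :
    DoubleCode.weight (h'.genMap a', h.genMap a)
      = k' * h.residueWeight a' + k * h.residueWeight a := by
  classical
  rw [← h.hammingNorm_genMap, h.residueWeight_eq h', ← h'.hammingNorm_genMap,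
    DoubleCode.weight]

theorem mem_oneGenCode_iff (h : IsRootPair lam k n c r) (h' : IsRootPair lam k' n c r)
    (a' a : GeomQuot c n) (x : Ambient lam (k' * n) × Ambient lam (k * n)) :
    x ∈ oneGenCode (h'.genMap a') (h.genMap a)
      ↔ ∃ b : GeomQuot c n, (h'.genMap (b * a'), h.genMap (b * a)) = x := by
  rw [oneGenCode, Submodule.mem_span_singleton]
  constructor
  · rintro ⟨p, rfl⟩
    refine ⟨Ideal.Quotient.mk _ p, ?_⟩
    rw [Prod.smul_mk, ← map_smul, ← map_smul]
    rfl
  · rintro ⟨b, rfl⟩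
    obtain ⟨p, rfl⟩ := Ideal.Quotient.mk_surjective b
    refine ⟨p, ?_⟩
    rw [Prod.smul_mk, ← map_smul, ← map_smul]
    rfl

theorem dim_oneGenCode (h : IsRootPair lam k n c r) (h' : IsRootPair lam k' n c r)
    {a' a : GeomQuot c n} (hinj : ∀ b : GeomQuot c n, b * a' = 0 → b * a = 0 → b = 0) :
    (oneGenCode (h'.genMap a') (h.genMap a)).dim = n - 1 := by
  set T := LinearMap.toSpanSingleton F[X] (Ambient lam (k' * n) × Ambient lam (k * n))
    (h'.genMap a', h.genMap a) with hT
  have hker : LinearMap.ker T = Ideal.span {scaledGeom c n} := by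
    ext p
    rw [LinearMap.mem_ker, hT, LinearMap.toSpanSingleton_apply, Prod.smul_mk, ← map_smul,
      ← map_smul, Prod.mk_eq_zero, map_eq_zero_iff _ h'.genMap_injective,
      map_eq_zero_iff _ h.genMap_injective, ← Ideal.Quotient.eq_zero_iff_mem]
    constructor
    · rintro ⟨h1, h2⟩
      exact hinj _ h1 h2
    · intro h0
      exact ⟨(congrArg (· * a') h0).trans (zero_mul _), (congrArg (· * a) h0).trans (zero_mul _)⟩
  have hrange : LinearMap.range T = oneGenCode (h'.genMap a') (h.genMap a) :=
    LinearMap.range_toSpanSingleton _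
  have e := (T.quotKerEquivRange.restrictScalars F).finrank_eq
  rw [hker, hrange, finrank_quotient_span_eq_natDegree,
    (natDegree_scaledGeom h.ne_zero_left h.pow_mul_eq h.n_pos).1] at e
  exact e.symm

theorem lt_relDist_oneGenCode (h : IsRootPair lam k n c r) (h' : IsRootPair lam k' n c r)
    (hn : 2 ≤ n) {δ : ℝ} (hδ : 0 ≤ δ) {a' a : GeomQuot c n}
    (hw : ∀ b : GeomQuot c n, b ≠ 0 → δ * ((k' : ℝ) * n + k * n)
      < k' * h.residueWeight (b * a') + k * h.residueWeight (b * a)) :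
    δ < (oneGenCode (h'.genMap a') (h.genMap a)).relDist := by
  have hN : (0 : ℝ) < (k' : ℝ) * n + k * n := by
    have := h.k_pos; have := h.n_pos; positivity
  have hweight : ∀ b : GeomQuot c n, b ≠ 0 → δ * ((k' : ℝ) * n + k * n)
      < DoubleCode.weight (h'.genMap (b * a'), h.genMap (b * a)) := by
    intro b hb
    rw [weight_genMap h h']
    push_cast
    exact hw b hb
  have hg := natDegree_scaledGeom h.ne_zero_left h.pow_mul_eq h.n_pos
  have hone : (1 : GeomQuot c n) ≠ 0 := by
    intro h1
    rw [← map_one (Ideal.Quotient.mk _), Ideal.Quotient.eq_zero_iff_mem,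
      Ideal.mem_span_singleton] at h1
    have := natDegree_le_of_dvd h1 one_ne_zero
    rw [hg.1, natDegree_one] at this
    omega
  have hne : {w | ∃ x ∈ oneGenCode (h'.genMap a') (h.genMap a), x ≠ 0
      ∧ DoubleCode.weight x = w}.Nonempty := by
    refine ⟨_, _, (mem_oneGenCode_iff h h' a' a _).2 ⟨1, rfl⟩, ?_, rfl⟩
    intro h0
    have h1 := hweight 1 hone
    have hz := weight_genMap h h' 0 0
    rw [map_zero, map_zero] at hz
    have h2 : h.residueWeight 0 = 0 := by
      simp [residueWeight, windowWeight]
    rw [h0, ← Prod.mk_zero_zero, hz, h2] at h1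
    simp only [mul_zero, add_zero, Nat.cast_zero] at h1
    exact absurd h1 (not_lt.2 (by positivity))
  obtain ⟨x, hx, hx0, hxw⟩ := Nat.sInf_mem hne
  obtain ⟨b, rfl⟩ := (mem_oneGenCode_iff h h' a' a x).1 hx
  have hb : b ≠ 0 := by
    rintro rfl
    simp at hx0
  rw [DoubleCode.relDist]
  push_cast
  rw [lt_div_iff₀ hN, DoubleCode.minWeight, ← hxw]
  exact hweight b hb

end IsRootPair

theorem uniformProb_congr {Ω Ω' : Type*} (e : Ω ≃ Ω') (P : Ω' → Prop) :
    uniformProb P = uniformProb fun x => P (e x) := by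
  rw [uniformProb, uniformProb, Nat.card_congr e,
    Nat.card_congr (e.subtypeEquiv (p := fun x => P (e x)) (q := P) fun _ => Iff.rfl)]

theorem uniformProb_le_one {Ω : Type*} [Finite Ω] (P : Ω → Prop) : uniformProb P ≤ 1 := by
  refine div_le_one_of_le₀ ?_ (Nat.cast_nonneg _)
  exact_mod_cast Nat.card_le_card_of_injective _ Subtype.val_injective

open Classical in
theorem one_sub_le_uniformProb {Ω : Type*} [Fintype Ω] [Nonempty Ω] {P Q : Ω → Prop}
    (h : ∀ x, ¬ Q x → P x) {ε : ℝ}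
    (hQ : ((Finset.univ.filter Q).card : ℝ) ≤ (Fintype.card Ω : ℝ) * ε) :
    1 - ε ≤ uniformProb P := by
  have hpos : (0 : ℝ) < Fintype.card Ω := by exact_mod_cast Fintype.card_pos
  rw [uniformProb, Nat.card_eq_fintype_card, Nat.card_eq_fintype_card, le_div_iff₀ hpos,
    Fintype.card_subtype]
  have h1 : Fintype.card Ω ≤ (Finset.univ.filter P).card + (Finset.univ.filter Q).card := by
    rw [← Finset.card_univ]
    refine (Finset.card_le_card ?_).trans (Finset.card_union_le _ _)
    intro x _
    by_cases hx : Q x <;> simp [hx, h x]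
  have h2 : (Fintype.card Ω : ℝ) ≤ (Finset.univ.filter P).card + (Finset.univ.filter Q).card := by
    exact_mod_cast h1
  linarith

theorem minFactorDegree_le {c : F} (hc : c ≠ 0) {n : ℕ} {p : F[X]} (hp : Irreducible p)
    (hd : p ∣ scaledGeom c n) : minFactorDegree F n ≤ p.natDegree := by
  have : Invertible (c⁻¹) := invertibleOfNonzero (inv_ne_zero hc)
  set σ := algEquivCMulXAddC (c⁻¹) (0 : F) with hσ
  have hσX : ∀ f, σ f = f.comp (C c⁻¹ * X) := by
    intro f
    rw [hσ, algEquivCMulXAddC_apply, C_0, add_zero]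
    rfl
  refine Nat.sInf_le ⟨σ p, ?_, ?_, ?_⟩
  · exact (MulEquiv.irreducible_iff (σ : F[X] ≃* F[X])).2 hp
  · have h1 := map_dvd σ hd
    rwa [scaledGeom, map_sum, Finset.sum_congr rfl (g := fun j => (X : F[X]) ^ j)] at h1
    intro j _
    rw [map_pow, hσX]
    simp only [mul_comp, C_comp, X_comp]
    rw [← mul_assoc, ← C_mul, mul_inv_cancel₀ hc, C_1, one_mul]
  · rw [hσX, natDegree_comp, natDegree_C_mul_X _ (inv_ne_zero hc), mul_one]

theorem minFactorDegree_pos {n : ℕ} (hn : 2 ≤ n) : 0 < minFactorDegree F n := by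
  have hne : {d | ∃ φ : F[X], Irreducible φ ∧ φ ∣ ∑ j ∈ Finset.range n, X ^ j
      ∧ φ.natDegree = d}.Nonempty := by
    have h1 := natDegree_scaledGeom (c := (1 : F)) (r := 1) one_ne_zero (n := n) (by simp)
      (by omega)
    obtain ⟨φ, hφ, hd⟩ := WfDvdMonoid.exists_irreducible_factor
      (not_isUnit_of_natDegree_pos _ (by rw [h1.1]; omega)) h1.2
    exact ⟨_, φ, hφ, by simpa [scaledGeom] using hd, rfl⟩
  obtain ⟨φ, hφ, -, hd⟩ := Nat.sInf_mem hne
  rw [minFactorDegree, ← hd]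
  exact hφ.natDegree_pos

open UniqueFactorizationMonoid in
theorem one_sub_le_codeProb [Fintype F] {lam : Fˣ} {k k' n : ℕ} {c r : F}
    (h : IsRootPair lam k n c r) (h' : IsRootPair lam k' n c r) {θ η ρ : ℝ} (hθ : 0 < θ)
    (hθ1 : θ ≤ 1)
    (hρ : ρ = (θ ^ (-η) * (1 + ((Fintype.card F : ℝ) - 1) * θ)) ^ 2 / Fintype.card F)
    (hρ1 : ρ ≤ 1) {P : DoubleCode lam (k' * n) (k * n) → Prop}
    (hP : ∀ a' a : GeomQuot c n, (∀ b : GeomQuot c n, b ≠ 0 →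
      2 * n * η < (h.residueWeight (b * a') : ℝ) + h.residueWeight (b * a)) →
      P (oneGenCode (h'.genMap a') (h.genMap a))) :
    1 - n * ((1 + ρ ^ minFactorDegree F n) ^ (n - 1) - 1) ≤ codeProb lam k' k n P
      ∧ codeProb lam k' k n P ≤ 1 := by
  classical
  have hg := natDegree_scaledGeom h.ne_zero_left h.pow_mul_eq h.n_pos
  have := finite_quotient_span hg.2
  have := Fintype.ofFinite (GeomQuot c n)
  have hμ : ∀ p ∈ normalizedFactors (scaledGeom c n), minFactorDegree F n ≤ p.natDegree :=
    fun p hp => minFactorDegree_le h.ne_zero_left (irreducible_of_normalized_factor p hp)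
      (dvd_of_mem_normalizedFactors hp)
  have hbad := card_exists_small_weight_le hg.2 h.n_pos h.ne_zero_right
    (topCoeff_periodic h.ne_zero_left h.pow_mul_eq h.n_pos)
    (eq_zero_of_topCoeff_eq_zero h.ne_zero_left h.pow_mul_eq h.n_pos) hμ hθ hθ1 hρ hρ1
  rw [codeProb, uniformProb_congr (h'.genEquiv.prodCongr h.genEquiv)]
  refine ⟨one_sub_le_uniformProb (Q := fun p : GeomQuot c n × GeomQuot c n =>
    ∃ b : GeomQuot c n, b ≠ 0 ∧ (h.residueWeight (b * p.1) : ℝ) + h.residueWeight (b * p.2)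
      ≤ 2 * n * η) ?_ ?_, uniformProb_le_one _⟩
  · rintro ⟨a', a⟩ hQ
    refine hP a' a fun b hb => ?_
    by_contra hlt
    exact hQ ⟨b, hb, not_lt.1 hlt⟩
  · rw [Fintype.card_prod, ← hg.1, Nat.cast_mul, ← sq]
    convert hbad <;> rfl

end TwistedCode

/-- The Chernoff parameter for `η` turns the moment bound into the `q`-ary entropy. -/
theorem exists_chernoff_parameter {q : ℕ} (hq : 2 ≤ q) {η : ℝ} (hη0 : 0 < η)
    (hη1 : η ≤ 1 - 1 / (q : ℝ)) (hent : entropyBase q η < 1 / 2) :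
    ∃ θ : ℝ, 0 < θ ∧ θ ≤ 1 ∧ 0 < (θ ^ (-η) * (1 + ((q : ℝ) - 1) * θ)) ^ 2 / q ∧
      (θ ^ (-η) * (1 + ((q : ℝ) - 1) * θ)) ^ 2 / q < 1 := by
  have hq' : (2 : ℝ) ≤ q := by exact_mod_cast hq
  have hq0 : (0 : ℝ) < q := by linarith
  have hq1 : (0 : ℝ) < q - 1 := by linarith
  have hη : 0 < 1 - η := by
    have : (0 : ℝ) < 1 / q := by positivity
    linarith
  set θ : ℝ := η / ((1 - η) * (q - 1)) with hθ
  have hθ0 : 0 < θ := by positivity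
  have hB : 1 + ((q : ℝ) - 1) * θ = (1 - η)⁻¹ := by
    rw [hθ]; field_simp; ring
  have hK : 0 < θ ^ (-η) * (1 + ((q : ℝ) - 1) * θ) := by
    rw [hB]; positivity
  have hlog : Real.log (θ ^ (-η) * (1 + ((q : ℝ) - 1) * θ)) = Real.qaryEntropy q η := by
    rw [hB, Real.log_mul (by positivity) (by positivity), Real.log_rpow hθ0, Real.log_inv, hθ,
      Real.log_div hη0.ne' (by positivity), Real.log_mul hη.ne' hq1.ne', Real.qaryEntropy,
      Real.binEntropy, Real.log_inv, Real.log_inv]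
    push_cast
    ring
  refine ⟨θ, hθ0, ?_, by positivity, ?_⟩
  · rw [hθ, div_le_one (by positivity)]
    have : q * η ≤ q * (1 - 1 / (q : ℝ)) := mul_le_mul_of_nonneg_left hη1 hq0.le
    rw [mul_sub, mul_one_div_cancel hq0.ne'] at this
    linarith
  · rw [div_lt_one hq0, ← Real.log_lt_log_iff (by positivity) hq0, Real.log_pow, hlog]
    rw [entropyBase, div_lt_iff₀ (Real.log_pos (by linarith))] at hent
    push_cast
    linarith

/-- If `log n = o(m)` then `n ((1 + ρ ^ m) ^ (n - 1) - 1)` tends to zero. -/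
theorem tendsto_mul_pow_sub_one {q : ℕ} (hq : 2 ≤ q) {n m : ℕ → ℕ} (hn : ∀ i, 2 ≤ n i)
    (hm : ∀ i, 0 < m i)
    (hlim : Tendsto (fun i => Real.logb q (n i) / (m i : ℝ)) atTop (𝓝 0)) {ρ : ℝ} (hρ0 : 0 < ρ)
    (hρ1 : ρ < 1) :
    Tendsto (fun i => (n i : ℝ) * ((1 + ρ ^ m i) ^ (n i - 1) - 1)) atTop (𝓝 0) := by
  have hlogq : 0 < Real.log q := Real.log_pos (by exact_mod_cast hq)
  have hlog2 : 0 < Real.log 2 := Real.log_pos one_lt_two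
  have hm' : ∀ i, (0 : ℝ) < m i := fun i => by exact_mod_cast hm i
  have hn' : ∀ i, (2 : ℝ) ≤ n i := fun i => by exact_mod_cast hn i
  have hlim' : Tendsto (fun i => Real.log (n i) / (m i : ℝ)) atTop (𝓝 0) := by
    have := hlim.const_mul (Real.log q)
    rw [mul_zero] at this
    refine this.congr fun i => ?_
    rw [Real.logb]
    field_simp
  have hminv : Tendsto (fun i => ((m i : ℝ))⁻¹) atTop (𝓝 0) := by
    have h1 := hlim'.const_mul (Real.log 2)⁻¹
    rw [mul_zero] at h1
    refine squeeze_zero (fun i => (inv_pos.2 (hm' i)).le) (fun i => ?_) h1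
    rw [div_eq_mul_inv, ← mul_assoc]
    refine le_mul_of_one_le_left (inv_pos.2 (hm' i)).le ?_
    rw [inv_mul_eq_div, one_le_div hlog2]
    exact Real.log_le_log two_pos (hn' i)
  have hmtop : Tendsto (fun i => (m i : ℝ)) atTop atTop := by
    have h1 : Tendsto (fun i => ((m i : ℝ))⁻¹) atTop (𝓝[>] 0) :=
      tendsto_nhdsWithin_iff.2 ⟨hminv, Eventually.of_forall fun i => inv_pos.2 (hm' i)⟩
    exact h1.inv_tendsto_nhdsGT_zero.congr fun i => by simp
  have hsq : Tendsto (fun i => (n i : ℝ) ^ 2 * ρ ^ m i) atTop (𝓝 0) := by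
    have h1 : Tendsto (fun i => 2 * (Real.log (n i) / (m i : ℝ)) + Real.log ρ) atTop
        (𝓝 (2 * 0 + Real.log ρ)) := (hlim'.const_mul 2).add_const _
    have h2 := hmtop.atTop_mul_neg (by simpa using Real.log_neg hρ0 hρ1) h1
    refine (Real.tendsto_exp_atBot.comp h2).congr fun i => ?_
    have hni : (0 : ℝ) < n i := by linarith [hn' i]
    rw [Function.comp_apply, ← Real.exp_log (show 0 < (n i : ℝ) ^ 2 * ρ ^ m i by positivity),
      Real.log_mul (by positivity) (by positivity), Real.log_pow, Real.log_pow]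
    congr 1
    have := (hm' i).ne'
    field_simp
    push_cast
    ring
  have hbound : ∀ᶠ i in atTop,
      (n i : ℝ) * ((1 + ρ ^ m i) ^ (n i - 1) - 1) ≤ 2 * ((n i : ℝ) ^ 2 * ρ ^ m i) := by
    filter_upwards [hsq.eventually (gt_mem_nhds one_pos)] with i hi
    have hni : (0 : ℝ) < n i := by linarith [hn' i]
    have hx : 0 ≤ (n i : ℝ) * ρ ^ m i := by positivity
    have hx1 : (n i : ℝ) * ρ ^ m i ≤ 1 := by
      refine le_trans ?_ hi.le
      rw [sq, mul_assoc]
      exact le_mul_of_one_le_left hx (by linarith [hn' i])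
    have h3 : (1 + ρ ^ m i) ^ (n i - 1) ≤ Real.exp (n i * ρ ^ m i) := by
      calc (1 + ρ ^ m i) ^ (n i - 1) ≤ (1 + ρ ^ m i) ^ n i :=
            pow_le_pow_right₀ (by linarith [pow_pos hρ0 (m i)]) (Nat.sub_le _ _)
        _ ≤ Real.exp (ρ ^ m i) ^ n i := by
            gcongr
            linarith [Real.add_one_le_exp (ρ ^ m i)]
        _ = _ := (Real.exp_nat_mul _ _).symm
    have h4 := Real.abs_exp_sub_one_le (x := n i * ρ ^ m i) (by rwa [abs_of_nonneg hx])
    rw [abs_of_nonneg hx] at h4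
    have h5 := (le_abs_self _).trans h4
    calc (n i : ℝ) * ((1 + ρ ^ m i) ^ (n i - 1) - 1)
        ≤ n i * (2 * (n i * ρ ^ m i)) := by gcongr; linarith
      _ = _ := by ring
  refine squeeze_zero' (Eventually.of_forall fun i => ?_) hbound (by simpa using hsq.const_mul 2)
  refine mul_nonneg (Nat.cast_nonneg _) (sub_nonneg.2 (one_le_pow₀ ?_))
  linarith [pow_pos hρ0 (m i)]

theorem theorem3p1 {F : Type*} [Field F] [Fintype F] (lam : Fˣ)
    (α' α : ℕ) (hα' : 0 < α') (hα : 0 < α)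
    (hmod : α' ≡ α [MOD orderOf lam]) (hcop : α.Coprime (orderOf lam))
    (n : ℕ → ℕ) (hn : ∀ i, 2 ≤ n i)
    (hncop : ∀ i, (n i).Coprime (Fintype.card F * orderOf lam))
    (hnlim : Tendsto
      (fun i => Real.logb (Fintype.card F) (n i) / (TwistedCode.minFactorDegree F (n i) : ℝ))
      atTop (𝓝 0))
    (δ : ℝ) (hδ0 : 0 < δ) (hδ1 : δ < 1 - 1 / (Fintype.card F : ℝ))
    (hdom : ((α' : ℝ) + α) / (2 * (min α' α : ℕ)) * δ ≤ 1 - 1 / (Fintype.card F : ℝ))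
    (hent : entropyBase (Fintype.card F) (((α' : ℝ) + α) / (2 * (min α' α : ℕ)) * δ) < 1 / 2) :
    Tendsto (fun i => TwistedCode.codeProb lam α' α (n i)
        fun D => δ < TwistedCode.DoubleCode.relDist D) atTop (𝓝 1) ∧
    Tendsto (fun i => TwistedCode.codeProb lam α' α (n i)
        fun D => TwistedCode.DoubleCode.dim D = n i - 1) atTop (𝓝 1) := by
  have hq : 2 ≤ Fintype.card F := Fintype.one_lt_card
  have hmin : (0 : ℝ) < (min α' α : ℕ) := by exact_mod_cast lt_min hα' hα
  have hα'R : (0 : ℝ) < α' := by exact_mod_cast hα'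
  have hαR : (0 : ℝ) < α := by exact_mod_cast hα
  obtain ⟨η, hη⟩ : ∃ η, η = ((α' : ℝ) + α) / (2 * (min α' α : ℕ)) * δ := ⟨_, rfl⟩
  have hη0 : 0 < η := by rw [hη]; positivity
  rw [← hη] at hdom hent
  obtain ⟨θ, hθ0, hθ1, hρ0, hρ1⟩ := exists_chernoff_parameter hq hη0 hdom hent
  have hroot : ∀ i, ∃ c r : F, TwistedCode.IsRootPair lam α (n i) c r ∧
      TwistedCode.IsRootPair lam α' (n i) c r := by
    intro i
    have hni : 0 < n i := by have := hn i; omega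
    have hnc : (n i).Coprime (orderOf lam) := (Nat.coprime_mul_iff_right.1 (hncop i)).2
    have hcop' : α'.Coprime (orderOf lam) := hmod.gcd_eq.trans hcop
    refine ⟨_, _, TwistedCode.isRootPair hα hni hcop hnc, ?_⟩
    have h' := TwistedCode.isRootPair hα' hni hcop' hnc
    rwa [TwistedCode.unitRoot_congr hmod,
      TwistedCode.unitRoot_congr (hmod.mul_right (n i))] at h'
  choose c r h h' using hroot
  have hlim := tendsto_mul_pow_sub_one hq hn
    (fun i => TwistedCode.minFactorDegree_pos (F := F) (hn i)) hnlim hρ0 hρ1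
  have main : ∀ P : ∀ i, TwistedCode.DoubleCode lam (α' * n i) (α * n i) → Prop,
      (∀ i, ∀ a' a : TwistedCode.GeomQuot (c i) (n i),
        (∀ b : TwistedCode.GeomQuot (c i) (n i), b ≠ 0 →
          2 * n i * η < ((h i).residueWeight (b * a') : ℝ) + (h i).residueWeight (b * a)) →
        P i (TwistedCode.oneGenCode ((h' i).genMap a') ((h i).genMap a))) →
      Tendsto (fun i => TwistedCode.codeProb lam α' α (n i) (P i)) atTop (𝓝 1) := by
    intro P hP
    have hb := fun i => TwistedCode.one_sub_le_codeProb (h i) (h' i) hθ0 hθ1 rfl hρ1.le (hP i)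
    refine tendsto_of_tendsto_of_tendsto_of_le_of_le (by simpa using hlim.const_sub 1)
      tendsto_const_nhds (fun i => (hb i).1) (fun i => (hb i).2)
  refine ⟨main (fun i D => δ < D.relDist) fun i a' a hw => ?_,
    main (fun i D => D.dim = n i - 1) fun i a' a hw => ?_⟩
  · refine (h i).lt_relDist_oneGenCode (h' i) (hn i) hδ0.le fun b hb => ?_
    have h1 := mul_lt_mul_of_pos_left (hw b hb) hmin
    have h2 : ((min α' α : ℕ) : ℝ) * (2 * n i * η) = δ * ((α' : ℝ) * n i + α * n i) := by
      rw [hη]; field_simp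
    have h3 : ((min α' α : ℕ) : ℝ) ≤ α' := by exact_mod_cast min_le_left _ _
    have h4 : ((min α' α : ℕ) : ℝ) ≤ α := by exact_mod_cast min_le_right _ _
    rw [← h2]
    refine h1.trans_le ?_
    rw [mul_add]
    gcongr
  · refine (h i).dim_oneGenCode (h' i) fun b h1 h2 => ?_
    by_contra hb
    have h3 := hw b hb
    have h4 : (h i).residueWeight 0 = 0 := by
      simp [TwistedCode.IsRootPair.residueWeight, windowWeight]
    rw [h1, h2, h4, Nat.cast_zero, add_zero] at h3
    exact absurd h3 (not_lt.2 (by positivity))
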